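/- For $n\ge 4$ and $a,b,c,k\in\mathbb Z_n\setminus\{0\}$ with $a,b,c$ pairwise distinct and, if $n$ is even, $k\ne n/2$, let $\mathrm{Nest}(n;a,b,c;k)$ be the (simple, $6$-valent) graph with vertex set $\{u_i : i\in\mathbb Z_n\}\cup\{v_i : i\in\mathbb Z_n\}$ and edges $\{u_i,u_{i+1}\}$, $\{v_i,v_{i+k}\}$, $\{u_i,v_i\}$, $\{u_i,v_{i+a}\}$, $\{u_i,v_{i+b}\}$, $\{u_i,v_{i+c}\}$ for $i\in\mathbb Z_n$. Let $\rho$ be its automorphism $u_i\mapsto u_{i+1}$, $v_i\mapsto v_{i+1}$ ($i\in\mathbb Z_n$). Let $n>8$ be even, let $\Gamma=\mathrm{Nest}(n;a,b,c;k)$ be such a graph (of order $2n$), and let $G\le\mathrm{Aut}(\Gamma)$ be a subgroup which contains $\rho$ and acts transitively on the edges of $\Gamma$. Let $C_{n/2}$ be the unique subgroup of order $n/2$ of the cyclic group $C=\langle\rho\rangle$. If the set of orbits of $C_{n/2}$ on the vertices of $\Gamma$ is a block system for $G$ (that is, $G$ permutes these orbits among themselves), then $C_{n/2}$ is a normal subgroup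 of $G$. -/

import Mathlib

/-- The vertices of a Nest graph: `u_i` is `Sum.inl i` and `v_i` is `Sum.inr i`, for `i` in
`ZMod n`. -/
abbrev NestVertex (n : ℕ) : Type := ZMod n ⊕ ZMod n

/-- The conditions on the parameters of a Nest graph. -/
structure IsNestParam (n : ℕ) (a b c k : ZMod n) : Prop where
  four_le : 4 ≤ n
  a_ne_zero : a ≠ 0
  b_ne_zero : b ≠ 0
  c_ne_zero : c ≠ 0
  k_ne_zero : k ≠ 0
  a_ne_b : a ≠ b
  a_ne_c : a ≠ c
  b_ne_c : b ≠ c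
  k_ne_half : Even n → k ≠ ((n / 2 : ℕ) : ZMod n)

/-- The edges of a Nest graph, each listed in one direction: rim edges `u_i u_{i+1}`, hub edges
`v_i v_{i+k}` and spoke edges `u_i v_i`, `u_i v_{i+a}`, `u_i v_{i+b}`, `u_i v_{i+c}`. -/
inductive NestEdge (n : ℕ) (a b c k : ZMod n) : NestVertex n → NestVertex n → Prop
  | rim (i : ZMod n) : NestEdge n a b c k (Sum.inl i) (Sum.inl (i + 1))
  | hub (i : ZMod n) : NestEdge n a b c k (Sum.inr i) (Sum.inr (i + k))
  | spoke0 (i : ZMod n) : NestEdge n a b c k (Sum.inl i) (Sum.inr i)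
  | spokeA (i : ZMod n) : NestEdge n a b c k (Sum.inl i) (Sum.inr (i + a))
  | spokeB (i : ZMod n) : NestEdge n a b c k (Sum.inl i) (Sum.inr (i + b))
  | spokeC (i : ZMod n) : NestEdge n a b c k (Sum.inl i) (Sum.inr (i + c))

/-- The Nest graph with parameters `(n; a, b, c; k)`. -/
def nestGraph (n : ℕ) (a b c k : ZMod n) : SimpleGraph (NestVertex n) :=
  SimpleGraph.fromRel (NestEdge n a b c k)

/-- The permutation `u_i ↦ u_{i+1}`, `v_i ↦ v_{i+1}` of the vertices. -/
def nestRotPerm (n : ℕ) : Equiv.Perm (NestVertex n) :=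
  Equiv.sumCongr (Equiv.addRight (1 : ZMod n)) (Equiv.addRight (1 : ZMod n))

theorem nestEdge_rot (n : ℕ) (a b c k : ZMod n) (x y : NestVertex n) :
    NestEdge n a b c k (nestRotPerm n x) (nestRotPerm n y) ↔ NestEdge n a b c k x y := by
  have fwd : ∀ (t : ZMod n) (x y : NestVertex n), NestEdge n a b c k x y →
      NestEdge n a b c k (Sum.map (· + t) (· + t) x) (Sum.map (· + t) (· + t) y) := by
    intro t x y h
    cases h with
    | rim i => simpa [add_right_comm] using NestEdge.rim (a := a) (b := b) (c := c) (k := k) (i + t)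
    | hub i => simpa [add_right_comm] using NestEdge.hub (a := a) (b := b) (c := c) (k := k) (i + t)
    | spoke0 i => exact NestEdge.spoke0 (i + t)
    | spokeA i =>
      simpa [add_right_comm] using NestEdge.spokeA (a := a) (b := b) (c := c) (k := k) (i + t)
    | spokeB i =>
      simpa [add_right_comm] using NestEdge.spokeB (a := a) (b := b) (c := c) (k := k) (i + t)
    | spokeC i =>
      simpa [add_right_comm] using NestEdge.spokeC (a := a) (b := b) (c := c) (k := k) (i + t)
  constructor
  · intro h
    have h' := fwd (-1) _ _ h
    rcases x with x | x <;> rcases y with y | y <;> simpa [nestRotPerm] using h'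
  · intro h
    have h' := fwd 1 _ _ h
    rcases x with x | x <;> rcases y with y | y <;> simpa [nestRotPerm] using h'

/-- The automorphism `ρ = (u_0, …, u_{n-1})(v_0, …, v_{n-1})` of a Nest graph. -/
def nestRot (n : ℕ) (a b c k : ZMod n) : nestGraph n a b c k ≃g nestGraph n a b c k where
  toEquiv := nestRotPerm n
  map_rel_iff' := by
    intro x y
    simp only [nestGraph, SimpleGraph.fromRel_adj, nestEdge_rot, ne_eq,
      EmbeddingLike.apply_eq_iff_eq]

/-- The group `G` of automorphisms of `Γ` acts transitively on the edges of `Γ`. -/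
def IsEdgeTransitiveUnder {V : Type*} (Γ : SimpleGraph V) (G : Subgroup (Γ ≃g Γ)) : Prop :=
  ∀ e ∈ Γ.edgeSet, ∀ f ∈ Γ.edgeSet, ∃ g ∈ G, Sym2.map g e = f

namespace NestGraph

/-! ### Powers of the rotation -/

variable {n : ℕ} {a b c k : ZMod n}

/-! `H` consists of the even powers of ρ, so its orbits are the even and odd halves of the rim (the
`u_i`) and of the hub (the `v_i`). As G permutes them, a conjugate of ρ² by an element of G
preserves each orbit. Any automorphism φ doing so acts on the rim cycle as a rotation or a
reflection (`cycle_aut`). It is determined by this action: edge transitivity moves a hub vertex to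
the rim, where neighbours in the opposite half determine a vertex, since n > 4
(`eq_one_of_fixes_rim`). So φ lies in `H` or φ² = 1. The conjugate of ρ² has order n/2 > 2, hence
lies in `H`. -/

theorem nestRot_inl (i : ZMod n) :
    nestRot n a b c k (Sum.inl i) = Sum.inl (i + 1) := rfl

theorem nestRot_inr (i : ZMod n) :
    nestRot n a b c k (Sum.inr i) = Sum.inr (i + 1) := rfl

theorem nestRot_zpow_apply (z : ℤ) (x : NestVertex n) :
    (nestRot n a b c k ^ z) x = Sum.map (· + (z : ZMod n)) (· + (z : ZMod n)) x := by
  induction z generalizing x with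
  | zero => rcases x with i | i <;> simp
  | succ m ih =>
    rw [zpow_add_one, RelIso.mul_apply, ih]
    rcases x with i | i <;> simp [nestRot_inl, nestRot_inr] <;> ring
  | pred m ih =>
    have key : ∀ y, (nestRot n a b c k ^ (-(m : ℤ) - 1)) (nestRot n a b c k y)
        = (nestRot n a b c k ^ (-(m : ℤ))) y := by
      intro y
      rw [← RelIso.mul_apply, ← zpow_add_one, sub_add_cancel]
    rcases x with i | i
    · have := key (Sum.inl (i - 1))
      rw [nestRot_inl, sub_add_cancel] at this
      rw [this, ih]
      simp; ring
    · have := key (Sum.inr (i - 1))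
      rw [nestRot_inr, sub_add_cancel] at this
      rw [this, ih]
      simp; ring

theorem nestRot_zpow_eq_one_iff (z : ℤ) :
    nestRot n a b c k ^ z = 1 ↔ (z : ZMod n) = 0 := by
  constructor
  · intro h
    have := nestRot_zpow_apply (a := a) (b := b) (c := c) (k := k) z (Sum.inl 0)
    rw [h] at this
    simpa using this.symm
  · intro h
    ext x
    rw [nestRot_zpow_apply, h]
    rcases x with i | i <;> simp

/-- A subgroup of index two of `⟨ρ⟩` consists of the even powers of `ρ`. -/
theorem mem_iff_of_card_eq_half (hn : 0 < n) (hn_even : Even n)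
    {H : Subgroup (nestGraph n a b c k ≃g nestGraph n a b c k)}
    (hH : H ≤ Subgroup.zpowers (nestRot n a b c k)) (hcard : Nat.card H = n / 2)
    (h : nestGraph n a b c k ≃g nestGraph n a b c k) :
    h ∈ H ↔ ∃ z : ℤ, h = nestRot n a b c k ^ (2 * z) := by
  obtain ⟨m, rfl⟩ := hn_even
  have hm : (m + m) / 2 = m := by omega
  rw [hm] at hcard
  have hle : H ≤ Subgroup.zpowers (nestRot (m + m) a b c k ^ 2) := by
    intro h hh
    obtain ⟨z, rfl⟩ := Subgroup.mem_zpowers_iff.1 (hH hh)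
    -- By Lagrange, n divides z · n/2, so z is even.
    have h1 : (⟨_, hh⟩ : H) ^ Nat.card H = 1 := pow_card_eq_one'
    have h2 : (nestRot (m + m) a b c k ^ z) ^ Nat.card H = 1 := congrArg Subtype.val h1
    rw [hcard, ← zpow_natCast, ← zpow_mul, nestRot_zpow_eq_one_iff,
      ZMod.intCast_zmod_eq_zero_iff_dvd] at h2
    obtain ⟨d, hd⟩ := h2
    have hm0 : (m : ℤ) ≠ 0 := by omega
    have hz : z = 2 * d := by
      apply mul_right_cancel₀ hm0
      rw [hd]; push_cast; ring
    exact Subgroup.mem_zpowers_iff.2 ⟨d, by rw [hz, zpow_mul]; rfl⟩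
  have hord : (nestRot (m + m) a b c k ^ 2) ^ m = 1 := by
    rw [← pow_mul, ← zpow_natCast, nestRot_zpow_eq_one_iff,
      ZMod.intCast_zmod_eq_zero_iff_dvd]
    exact ⟨1, by push_cast; ring⟩
  have hfin : IsOfFinOrder (nestRot (m + m) a b c k ^ 2) :=
    isOfFinOrder_iff_pow_eq_one.2 ⟨m, by omega, hord⟩
  have : Finite (Subgroup.zpowers (nestRot (m + m) a b c k ^ 2)) := by
    exact (finite_zpowers.2 hfin).to_subtype
  have heq := Subgroup.eq_of_le_of_card_ge hle (by
    rw [Nat.card_zpowers, hcard]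
    exact Nat.le_of_dvd (by omega) (orderOf_dvd_of_pow_eq_one hord))
  rw [heq, Subgroup.mem_zpowers_iff]
  constructor
  · rintro ⟨z, rfl⟩
    exact ⟨z, by rw [zpow_mul]; rfl⟩
  · rintro ⟨z, rfl⟩
    exact ⟨z, by rw [zpow_mul]; rfl⟩

/-! ### Adjacency and the rim cycle -/

theorem adj_inl_inl (hn : 1 < n) (i j : ZMod n) :
    (nestGraph n a b c k).Adj (Sum.inl i) (Sum.inl j) ↔ j = i + 1 ∨ j = i - 1 := by
  have : Fact (1 < n) := ⟨hn⟩
  simp only [nestGraph, SimpleGraph.fromRel_adj]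
  constructor
  · rintro ⟨-, h | h⟩
    · cases h; exact Or.inl rfl
    · cases h; exact Or.inr (by ring)
  · rintro (rfl | rfl)
    · exact ⟨by simp, Or.inl (.rim i)⟩
    · refine ⟨by simp [sub_eq_add_neg], Or.inr ?_⟩
      simpa using NestEdge.rim (a := a) (b := b) (c := c) (k := k) (i - 1)

theorem adj_inr_inl (i : ZMod n) :
    (nestGraph n a b c k).Adj (Sum.inr i) (Sum.inl i) := by
  simp only [nestGraph, SimpleGraph.fromRel_adj]
  exact ⟨by simp, Or.inr (.spoke0 i)⟩

theorem natCast_ne_zero {d : ℕ} (h0 : 0 < d) (hd : d < n) : (d : ZMod n) ≠ 0 := by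
  rw [Ne, ZMod.natCast_eq_zero_iff]
  exact fun h => absurd (Nat.le_of_dvd h0 h) (by omega)

/-- A permutation of `ZMod n` preserving adjacency in the cycle is a rotation or a reflection. -/
theorem cycle_aut (h2 : (2 : ZMod n) ≠ 0) (f : ZMod n → ZMod n) (hf : Function.Injective f)
    (hadj : ∀ i, f (i + 1) = f i + 1 ∨ f (i + 1) = f i - 1) :
    (∀ z : ℤ, f z = f 0 + z) ∨ (∀ z : ℤ, f z = f 0 - z) := by
  have hne : ∀ i : ZMod n, f (i + 1 + 1) ≠ f i := fun i h => h2 (by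
    have := hf h
    linear_combination this)
  -- By injectivity the walk `f` never turns back, so its first step ε is repeated forever; the
  -- induction carries two consecutive values.
  have gen : ∀ ε : ZMod n, f 1 = f 0 + ε → (ε = 1 ∨ ε = -1) → ∀ z : ℤ,
      f z = f 0 + z * ε ∧ f (z + 1) = f 0 + (z + 1) * ε := by
    intro ε h1 hε z
    induction z with
    | zero => simpa using h1
    | succ m ih =>
      push_cast at ih ⊢
      refine ⟨ih.2, ?_⟩
      have e1 := hadj (m + 1)
      have e2 := hne m
      rw [ih.1] at e2
      rw [ih.2] at e1
      rcases hε with rfl | rfl <;> rcases e1 with e | e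
      · rw [e]; ring
      · exact absurd (by rw [e]; ring) e2
      · exact absurd (by rw [e]; ring) e2
      · rw [e]; ring
    | pred m ih =>
      push_cast at ih ⊢
      have e3 : (-(m : ZMod n) - 1 + 1) = -m := by ring
      rw [e3]
      refine ⟨?_, ih.1⟩
      have e1 := hadj (-m - 1)
      have e2 := hne (-m - 1)
      rw [e3] at e1 e2
      rw [ih.2] at e2
      rw [ih.1] at e1
      rcases hε with rfl | rfl <;> rcases e1 with e | e
      · linear_combination -e
      · exact absurd (by linear_combination e) e2
      · exact absurd (by linear_combination e) e2
      · linear_combination -e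
  rcases hadj 0 with h | h <;> rw [zero_add] at h
  · exact Or.inl fun z => by simpa using (gen 1 h (Or.inl rfl) z).1
  · refine Or.inr fun z => ?_
    have := (gen (-1) (by rw [h]; ring) (Or.inr rfl) z).1
    rw [this]; ring

/-! ### Orbits of the even rotations -/

section Orbits

variable {H : Subgroup (nestGraph n a b c k ≃g nestGraph n a b c k)}

theorem mem_orbit_iff (hmem : ∀ h, h ∈ H ↔ ∃ z : ℤ, h = nestRot n a b c k ^ (2 * z))
    (x y : NestVertex n) :
    y ∈ MulAction.orbit H x ↔ ∃ z : ℤ, y = (nestRot n a b c k ^ (2 * z)) x := by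
  constructor
  · rintro ⟨⟨h, hh⟩, rfl⟩
    obtain ⟨z, rfl⟩ := (hmem h).1 hh
    exact ⟨z, rfl⟩
  · rintro ⟨z, rfl⟩
    exact ⟨⟨_, (hmem _).2 ⟨z, rfl⟩⟩, rfl⟩

theorem mem_orbit_inl_iff (hmem : ∀ h, h ∈ H ↔ ∃ z : ℤ, h = nestRot n a b c k ^ (2 * z))
    (i : ZMod n) (y : NestVertex n) :
    y ∈ MulAction.orbit H (Sum.inl i : NestVertex n) ↔ ∃ z : ℤ, y = Sum.inl (i + 2 * z) := by
  rw [mem_orbit_iff hmem]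
  simp [nestRot_zpow_apply]

/-- A power of ρ is determined by the image of one vertex, so `H` acts freely. -/
theorem ncard_orbit (hH : H ≤ Subgroup.zpowers (nestRot n a b c k)) (x : NestVertex n) :
    (MulAction.orbit H x).ncard = Nat.card H := by
  have hinj : Function.Injective fun h : H => h • x := by
    rintro ⟨h, hh⟩ ⟨g, hg⟩ e
    obtain ⟨z, rfl⟩ := Subgroup.mem_zpowers_iff.1 (hH hh)
    obtain ⟨w, rfl⟩ := Subgroup.mem_zpowers_iff.1 (hH hg)
    change (nestRot n a b c k ^ z) x = (nestRot n a b c k ^ w) x at e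
    rw [nestRot_zpow_apply, nestRot_zpow_apply] at e
    have hzw : (z : ZMod n) = w := by
      rcases x with i | i <;> simpa using e
    refine Subtype.ext (RelIso.ext fun y => ?_)
    change (nestRot n a b c k ^ z) y = (nestRot n a b c k ^ w) y
    rw [nestRot_zpow_apply, nestRot_zpow_apply, hzw]
  rw [← Nat.card_coe_set_eq]
  exact Nat.card_range_of_injective hinj

end Orbits

theorem exists_mem_apply_eq_inl (G : Subgroup (nestGraph n a b c k ≃g nestGraph n a b c k))
    (hn : 1 < n) (hG : IsEdgeTransitiveUnder (nestGraph n a b c k) G)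
    {x y : NestVertex n} (hxy : (nestGraph n a b c k).Adj x y) :
    ∃ g ∈ G, (g x = Sum.inl 0 ∧ g y = Sum.inl 1) ∨ (g x = Sum.inl 1 ∧ g y = Sum.inl 0) := by
  have h01 : (nestGraph n a b c k).Adj (Sum.inl 0) (Sum.inl 1) := by
    rw [adj_inl_inl hn]; simp
  obtain ⟨g, hg, e⟩ := hG s(x, y) hxy s(Sum.inl 0, Sum.inl 1) h01
  exact ⟨g, hg, by simpa using e⟩

/-- An edge at `x` is carried to `u_0 u_1`; if `x` lands on `u_1`, composing with ρ corrects this.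
-/
theorem exists_mem_apply_eq (G : Subgroup (nestGraph n a b c k ≃g nestGraph n a b c k))
    (hn : 1 < n) (hG : IsEdgeTransitiveUnder (nestGraph n a b c k) G)
    (hρ : nestRot n a b c k ∈ G) (x : NestVertex n) : ∃ g ∈ G, g (Sum.inl 0) = x := by
  obtain ⟨y, hxy⟩ : ∃ y, (nestGraph n a b c k).Adj x y := by
    rcases x with i | i
    · exact ⟨_, (adj_inr_inl i).symm⟩
    · exact ⟨_, adj_inr_inl i⟩
  obtain ⟨g, hg, ⟨h, -⟩ | ⟨h, -⟩⟩ := exists_mem_apply_eq_inl G hn hG hxy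
  · exact ⟨g⁻¹, G.inv_mem hg, by rw [← h, ← RelIso.mul_apply, inv_mul_cancel]; rfl⟩
  · refine ⟨g⁻¹ * nestRot n a b c k, G.mul_mem (G.inv_mem hg) hρ, ?_⟩
    rw [RelIso.mul_apply, nestRot_inl, zero_add, ← h, ← RelIso.mul_apply, inv_mul_cancel]; rfl

/-! ### The group permutes the orbits -/

section Blocks

open scoped Pointwise

variable {G H : Subgroup (nestGraph n a b c k ≃g nestGraph n a b c k)}

theorem nestRot_smul_orbit (hmem : ∀ h, h ∈ H ↔ ∃ z : ℤ, h = nestRot n a b c k ^ (2 * z))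
    (x : NestVertex n) :
    nestRot n a b c k • MulAction.orbit H x = MulAction.orbit H (nestRot n a b c k x) := by
  ext y
  rw [Set.mem_smul_set]
  simp only [mem_orbit_iff hmem]
  have key : ∀ z : ℤ, nestRot n a b c k ((nestRot n a b c k ^ (2 * z)) x)
      = (nestRot n a b c k ^ (2 * z)) (nestRot n a b c k x) := by
    intro z
    rw [← RelIso.mul_apply, ← RelIso.mul_apply, mul_self_zpow, mul_zpow_self]
  constructor
  · rintro ⟨_, ⟨z, rfl⟩, rfl⟩
    exact ⟨z, key z⟩
  · rintro ⟨z, rfl⟩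
    exact ⟨_, ⟨z, rfl⟩, key z⟩

/-- Translates of the block `{u_0, u_2, …}` are again orbits. -/
theorem smul_orbit_inl_zero (hn : 0 < n) (hn_even : Even n)
    (hmem : ∀ h, h ∈ H ↔ ∃ z : ℤ, h = nestRot n a b c k ^ (2 * z))
    (hH : H ≤ Subgroup.zpowers (nestRot n a b c k)) (hcard : Nat.card H = n / 2)
    (hρ : nestRot n a b c k ∈ G)
    (hB : MulAction.IsBlock G (MulAction.orbit H (Sum.inl 0 : NestVertex n)))
    {g : nestGraph n a b c k ≃g nestGraph n a b c k} (hg : g ∈ G) :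
    g • MulAction.orbit H (Sum.inl 0 : NestVertex n) = MulAction.orbit H (g (Sum.inl 0)) := by
  have : NeZero n := ⟨hn.ne'⟩
  set B := MulAction.orbit H (Sum.inl 0 : NestVertex n) with hBdef
  have hdis : ∀ g₁ ∈ G, ∀ g₂ ∈ G, g₁ • B = g₂ • B ∨ Disjoint (g₁ • B) (g₂ • B) :=
    fun g₁ h₁ g₂ h₂ => by
      have := hB (g₁ := ⟨g₁, h₁⟩) (g₂ := ⟨g₂, h₂⟩)
      by_cases e : g₁ • B = g₂ • B
      · exact Or.inl e
      · exact Or.inr (this e)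
  have hself : (Sum.inl 0 : NestVertex n) ∈ B := MulAction.mem_orbit_self _
  have hgself : g (Sum.inl 0) ∈ g • B := ⟨_, hself, rfl⟩
  have hρB := nestRot_smul_orbit hmem (Sum.inl 0 : NestVertex n)
  have hmeet : ∀ r ∈ G, ∀ x, r • B = MulAction.orbit H x → ∀ y ∈ MulAction.orbit H x,
      ∀ g ∈ G, y ∈ g • B → g • B = MulAction.orbit H y := by
    intro r hr x hx y hy g hg hyg
    rw [MulAction.orbit_eq_iff.2 hy, ← hx]
    refine (hdis g hg r hr).resolve_right fun h => ?_
    exact Set.disjoint_left.1 h hyg (by rwa [hx])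
  -- `B` and ρ`B` are translates covering the rim, so a translate that meets the rim is one of them.
  have hinl : ∀ (i : ZMod n), ∀ g ∈ G, Sum.inl i ∈ g • B →
      g • B = MulAction.orbit H (Sum.inl i : NestVertex n) := by
    intro i g hg hi
    rw [← ZMod.natCast_zmod_val i] at hi ⊢
    obtain ⟨m, hm | hm⟩ := Nat.even_or_odd' i.val
    · refine hmeet 1 G.one_mem (Sum.inl 0) (one_smul _ _) _ ?_ g hg hi
      rw [mem_orbit_inl_iff hmem]
      exact ⟨m, by rw [hm]; push_cast; simp⟩
    · refine hmeet _ hρ _ hρB _ ?_ g hg hi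
      rw [nestRot_inl, mem_orbit_inl_iff hmem]
      exact ⟨m, by rw [hm]; push_cast; congr 1; ring⟩
  rcases hgx : g (Sum.inl 0) with i | i
  · exact hinl i g hg (hgx ▸ hgself)
  have hsub : ∀ g ∈ G, ∀ i, Sum.inr i ∈ g • B → g • B ⊆ Set.range Sum.inr := by
    intro g hg i hi y hy
    rcases y with j | j
    · rw [hinl j g hg hy, mem_orbit_inl_iff hmem] at hi
      obtain ⟨z, hz⟩ := hi
      cases hz
    · exact ⟨j, rfl⟩
  have hcardB : ∀ g : nestGraph n a b c k ≃g nestGraph n a b c k, (g • B).ncard = n / 2 := by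
    intro g
    rw [← hcard, ← ncard_orbit hH (Sum.inl 0)]
    exact Set.ncard_image_of_injective _ g.injective
  have hgi : Sum.inr i ∈ g • B := hgx ▸ hgself
  set ρ := nestRot n a b c k with hρdef
  have hρρ : ρ * (ρ * g) ∈ G := G.mul_mem hρ (G.mul_mem hρ hg)
  have h1 : Sum.inr (i + 1) ∈ (ρ * g) • B := by
    rw [mul_smul]; exact ⟨_, hgi, nestRot_inr i⟩
  have h2 : Sum.inr (i + 1 + 1) ∈ (ρ * (ρ * g)) • B := by
    rw [mul_smul]; exact ⟨_, h1, nestRot_inr _⟩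
  -- Otherwise g`B`, ρg`B`, ρ²g`B` would be three disjoint sets of size n/2 in the hub, which has
  -- only n vertices.
  have hstab : (ρ ^ 2) • g • B = g • B := by
    by_contra hne
    have hne' : (ρ * (ρ * g)) • B ≠ g • B := by
      intro h; exact hne (by rw [← mul_smul, pow_two, mul_assoc, h])
    have hne1 : (ρ * g) • B ≠ g • B := by
      intro h
      apply hne'
      rw [mul_smul, h, ← mul_smul, h]
    have hne2 : (ρ * (ρ * g)) • B ≠ (ρ * g) • B := by
      intro h
      rw [mul_smul ρ, mul_smul ρ g] at h
      exact hne1 (by rw [mul_smul]; exact MulAction.injective ρ h)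
    have d1 := (hdis _ (G.mul_mem hρ hg) g hg).resolve_left hne1
    have d2 := (hdis _ hρρ _ (G.mul_mem hρ hg)).resolve_left hne2
    have d3 := (hdis _ hρρ g hg).resolve_left hne'
    have hle : ((g • B ∪ (ρ * g) • B) ∪ (ρ * (ρ * g)) • B).ncard
        ≤ (Set.range (Sum.inr : ZMod n → NestVertex n)).ncard :=
      Set.ncard_le_ncard (Set.union_subset (Set.union_subset (hsub g hg _ hgi)
        (hsub _ (G.mul_mem hρ hg) _ h1)) (hsub _ hρρ _ h2))
    rw [Set.ncard_union_eq (Set.disjoint_union_left.2 ⟨d3.symm, d2.symm⟩),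
      Set.ncard_union_eq d1.symm, hcardB, hcardB, hcardB, ← Nat.card_coe_set_eq,
      Nat.card_range_of_injective Sum.inr_injective, Nat.card_zmod] at hle
    obtain ⟨m, rfl⟩ := hn_even
    omega
  symm
  apply Set.eq_of_subset_of_ncard_le
  · intro y hy
    obtain ⟨z, rfl⟩ := (mem_orbit_iff hmem _ _).1 hy
    have hz : (ρ ^ 2) ^ z ∈ MulAction.stabilizer _ (g • B) :=
      Subgroup.zpow_mem _ (MulAction.mem_stabilizer_iff.2 hstab) z
    rw [← MulAction.mem_stabilizer_iff.1 hz, zpow_mul]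
    exact ⟨_, hgi, rfl⟩
  · rw [hcardB, ncard_orbit hH, hcard]
  · exact Set.toFinite _

/-- By vertex transitivity every orbit is a translate of that of `u_0`. -/
theorem apply_mem_orbit (hn : 1 < n) (hn_even : Even n)
    (hmem : ∀ h, h ∈ H ↔ ∃ z : ℤ, h = nestRot n a b c k ^ (2 * z))
    (hH : H ≤ Subgroup.zpowers (nestRot n a b c k)) (hcard : Nat.card H = n / 2)
    (hG : IsEdgeTransitiveUnder (nestGraph n a b c k) G) (hρ : nestRot n a b c k ∈ G)
    (hB : MulAction.IsBlock G (MulAction.orbit H (Sum.inl 0 : NestVertex n)))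
    {g : nestGraph n a b c k ≃g nestGraph n a b c k} (hg : g ∈ G) {x y : NestVertex n}
    (hxy : y ∈ MulAction.orbit H x) : g y ∈ MulAction.orbit H (g x) := by
  obtain ⟨h, hh, rfl⟩ := exists_mem_apply_eq G hn hG hρ x
  have key := fun {g} hg => smul_orbit_inl_zero (by omega : 0 < n) hn_even hmem hH hcard hρ hB
    (g := g) hg
  rw [← key hh] at hxy
  rw [← RelIso.mul_apply, ← key (G.mul_mem hg hh), mul_smul]
  exact ⟨y, hxy, rfl⟩

end Blocks

/-! ### Automorphisms preserving every orbit -/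

variable {G H : Subgroup (nestGraph n a b c k ≃g nestGraph n a b c k)}

/-- An automorphism preserving every orbit of `H` and fixing the rim is trivial. -/
theorem eq_one_of_fixes_rim (hn : 4 < n)
    (hmem : ∀ h, h ∈ H ↔ ∃ z : ℤ, h = nestRot n a b c k ^ (2 * z))
    (hG : IsEdgeTransitiveUnder (nestGraph n a b c k) G)
    (hperm : ∀ g ∈ G, ∀ x y : NestVertex n, y ∈ MulAction.orbit H x →
      g y ∈ MulAction.orbit H (g x))
    (φ : nestGraph n a b c k ≃g nestGraph n a b c k)
    (hφ : ∀ x, φ x ∈ MulAction.orbit H x) (hfix : ∀ i, φ (Sum.inl i) = Sum.inl i) :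
    φ = 1 := by
  have hn1 : 1 < n := by omega
  ext x
  rcases x with i | j
  · exact hfix i
  obtain ⟨g, hg, hcase⟩ := exists_mem_apply_eq_inl G hn1 hG (adj_inr_inl (a := a) (b := b)
    (c := c) (k := k) j)
  obtain ⟨i, l, hgi, hgl, hil⟩ : ∃ i l : ZMod n, g (Sum.inr j) = Sum.inl i ∧
      g (Sum.inl j) = Sum.inl l ∧ (l = i + 1 ∨ l = i - 1) := by
    rcases hcase with ⟨h1, h2⟩ | ⟨h1, h2⟩
    · exact ⟨_, _, h1, h2, by simp⟩
    · exact ⟨_, _, h1, h2, by simp⟩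
  have himg := hperm g hg _ _ (hφ (Sum.inr j))
  rw [hgi, mem_orbit_inl_iff hmem] at himg
  obtain ⟨s, hs⟩ := himg
  -- φ fixes the orbit of `u_j` pointwise, so neighbours of `v_j` there are neighbours of `φ v_j`;
  -- this is transported by `g`.
  have hnbr : ∀ z : ℤ, ((nestGraph n a b c k).Adj (Sum.inl i) (Sum.inl (l + 2 * z)) →
      (nestGraph n a b c k).Adj (Sum.inl (i + 2 * s)) (Sum.inl (l + 2 * z))) := by
    intro z h
    have hw : (Sum.inl (l + 2 * z) : NestVertex n) ∈ MulAction.orbit H (Sum.inl l) :=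
      (mem_orbit_inl_iff hmem _ _).2 ⟨z, rfl⟩
    have hginv : ∀ x, g (g⁻¹ x) = x := fun x => by
      rw [← RelIso.mul_apply, mul_inv_cancel]; rfl
    obtain ⟨p, hp⟩ : ∃ p, g (Sum.inl p) = Sum.inl (l + 2 * z) := by
      have hp := hperm _ (G.inv_mem hg) _ _ hw
      rw [← hgl, ← RelIso.mul_apply, inv_mul_cancel] at hp
      obtain ⟨t, ht⟩ := (mem_orbit_inl_iff hmem j _).1 hp
      exact ⟨_, by rw [← ht, hginv]⟩
    rw [← hgi, ← hp, g.map_rel_iff] at h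
    rw [← hs, ← hp, g.map_rel_iff, ← hfix p, φ.map_rel_iff]
    exact h
  have e1 : (nestGraph n a b c k).Adj (Sum.inl (i + 2 * s)) (Sum.inl (i + 1)) := by
    have hi : (nestGraph n a b c k).Adj (Sum.inl i) (Sum.inl (i + 1)) := by
      rw [adj_inl_inl hn1]; simp
    rcases hil with rfl | rfl
    · simpa using hnbr 0 (by simpa using hi)
    · have e : i - 1 + 2 * ((1 : ℤ) : ZMod n) = i + 1 := by push_cast; ring
      have := hnbr 1
      rw [e] at this
      exact this hi
  have e2 : (nestGraph n a b c k).Adj (Sum.inl (i + 2 * s)) (Sum.inl (i - 1)) := by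
    have hi : (nestGraph n a b c k).Adj (Sum.inl i) (Sum.inl (i - 1)) := by
      rw [adj_inl_inl hn1]; simp
    rcases hil with rfl | rfl
    · have e : i + 1 + 2 * ((-1 : ℤ) : ZMod n) = i - 1 := by push_cast; ring
      have := hnbr (-1)
      rw [e] at this
      exact this hi
    · simpa using hnbr 0 (by simpa using hi)
  rw [adj_inl_inl hn1] at e1 e2
  have h4 : (4 : ZMod n) ≠ 0 := by exact_mod_cast natCast_ne_zero (n := n) (by omega) hn
  -- A vertex other than `u_i` adjacent to both `u_{i+1}` and `u_{i-1}` would force 4 = 0.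
  have hs0 : (2 * s : ZMod n) = 0 := by
    rcases e1 with e1 | e1
    · linear_combination -e1
    rcases e2 with e2 | e2
    · exact absurd (by linear_combination e1 - e2) h4
    · linear_combination -e2
  rw [hs0, add_zero, ← hgi] at hs
  exact g.injective hs

/-- An automorphism preserving every orbit of `H` belongs to `H` or is an involution. -/
theorem mem_or_mul_self_eq_one_of_preserves_orbits (hn : 4 < n)
    (hmem : ∀ h, h ∈ H ↔ ∃ z : ℤ, h = nestRot n a b c k ^ (2 * z))
    (hG : IsEdgeTransitiveUnder (nestGraph n a b c k) G)
    (hperm : ∀ g ∈ G, ∀ x y : NestVertex n, y ∈ MulAction.orbit H x →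
      g y ∈ MulAction.orbit H (g x))
    (φ : nestGraph n a b c k ≃g nestGraph n a b c k)
    (hφ : ∀ x, φ x ∈ MulAction.orbit H x) : φ ∈ H ∨ φ * φ = 1 := by
  have hrim : ∀ i : ZMod n, ∃ j, φ (Sum.inl i) = Sum.inl j := fun i => by
    obtain ⟨z, hz⟩ := (mem_orbit_inl_iff hmem _ _).1 (hφ (Sum.inl i))
    exact ⟨_, hz⟩
  choose f hf using hrim
  have hinj : Function.Injective f := fun i j h => by
    have : φ (Sum.inl i) = φ (Sum.inl j) := by rw [hf, hf, h]
    simpa using φ.injective this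
  have hadj : ∀ i, f (i + 1) = f i + 1 ∨ f (i + 1) = f i - 1 := fun i => by
    rw [← adj_inl_inl (a := a) (b := b) (c := c) (k := k) (by omega : 1 < n), ← hf, ← hf,
      φ.map_rel_iff, adj_inl_inl (by omega)]
    simp
  have h2 : (2 : ZMod n) ≠ 0 := by
    exact_mod_cast natCast_ne_zero (n := n) (by omega) (by omega : 2 < n)
  rcases cycle_aut h2 f hinj hadj with hrot | hrefl
  · left
    obtain ⟨s, hs⟩ := (mem_orbit_inl_iff hmem _ _).1 (hφ (Sum.inl 0))
    rw [hf, Sum.inl.injEq, zero_add] at hs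
    have hψ : nestRot n a b c k ^ (2 * -s) ∈ H := (hmem _).2 ⟨_, rfl⟩
    have : nestRot n a b c k ^ (2 * -s) * φ = 1 := by
      refine eq_one_of_fixes_rim hn hmem hG hperm _ (fun x => ?_) fun i => ?_
      · exact MulAction.mem_orbit_of_mem_orbit (⟨_, hψ⟩ : H) (hφ x)
      · rw [RelIso.mul_apply, hf, nestRot_zpow_apply, ← ZMod.intCast_zmod_cast i, hrot, hs]
        simp
    rw [eq_inv_of_mul_eq_one_right this]
    exact H.inv_mem hψ
  · right
    refine eq_one_of_fixes_rim hn hmem hG hperm _ (fun x => ?_) fun i => ?_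
    · rw [RelIso.mul_apply, ← MulAction.orbit_eq_iff.2 (hφ x)]
      exact hφ _
    · rw [RelIso.mul_apply, hf, hf, ← ZMod.intCast_zmod_cast i, hrefl,
        ← ZMod.intCast_zmod_cast (f 0 - _), hrefl]
      simp

end NestGraph

open NestGraph in
theorem mainTheorem3 (n : ℕ) (a b c k : ZMod n) (hparam : IsNestParam n a b c k)
    (hn : 8 < n) (hn_even : Even n)
    (G : Subgroup (nestGraph n a b c k ≃g nestGraph n a b c k))
    (hG : IsEdgeTransitiveUnder (nestGraph n a b c k) G)
    (hρ : nestRot n a b c k ∈ G)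
    (H : Subgroup (nestGraph n a b c k ≃g nestGraph n a b c k))
    (hH : H ≤ Subgroup.zpowers (nestRot n a b c k)) (hH_card : Nat.card H = n / 2)
    (hblock : MulAction.IsBlockSystem G
      (Set.range fun x : NestVertex n => MulAction.orbit H x)) :
    H ≤ G ∧ (H.subgroupOf G).Normal := by
  have hmem := mem_iff_of_card_eq_half (by omega : 0 < n) hn_even hH hH_card
  have hperm : ∀ g ∈ G, ∀ x y : NestVertex n, y ∈ MulAction.orbit H x →
      g y ∈ MulAction.orbit H (g x) := fun g hg x y hxy =>
    apply_mem_orbit (by omega : 1 < n) hn_even hmem hH hH_card hG hρ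
      (hblock.2 ⟨Sum.inl 0, rfl⟩) hg hxy
  refine ⟨hH.trans (by simpa using hρ), ⟨?_⟩⟩
  rintro ⟨h, hhG⟩ hh ⟨g, hg⟩
  rw [Subgroup.mem_subgroupOf] at hh ⊢
  change h ∈ H at hh
  change g * h * g⁻¹ ∈ H
  have hconj : ∀ h ∈ H, ∀ x, (g * h * g⁻¹) x ∈ MulAction.orbit H x := by
    intro h hh x
    have hx : g (g⁻¹ x) = x := by rw [← RelIso.mul_apply, mul_inv_cancel]; rfl
    have := hperm g hg (g⁻¹ x) (h (g⁻¹ x)) ⟨⟨h, hh⟩, rfl⟩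
    rwa [hx] at this
  -- If the conjugate squared to 1, then ρ⁴ = 1, impossible for n > 4.
  have hsq : g * nestRot n a b c k ^ (2 : ℤ) * g⁻¹ ∈ H := by
    have hρH : nestRot n a b c k ^ (2 : ℤ) ∈ H := (hmem _).2 ⟨1, rfl⟩
    refine (mem_or_mul_self_eq_one_of_preserves_orbits (by omega) hmem hG hperm _
      (hconj _ hρH)).resolve_right ?_
    intro h1
    have h4 : nestRot n a b c k ^ (4 : ℤ) = 1 := by
      have : g * nestRot n a b c k ^ (4 : ℤ) * g⁻¹ = 1 := by
        rw [← h1, show (4 : ℤ) = 2 + 2 from rfl, zpow_add]; group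
      simpa [mul_inv_eq_one] using this
    rw [nestRot_zpow_eq_one_iff] at h4
    exact natCast_ne_zero (n := n) (d := 4) (by omega) (by omega) (by exact_mod_cast h4)
  obtain ⟨z, rfl⟩ := (hmem h).1 hh
  rw [zpow_mul, ← conj_zpow]
  exact H.zpow_mem hsq z
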